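/- Let $G=(V,E)$ be a finite connected graph (multiple edges and loops are allowed). Let $q\ge 1$ and $p\in[0,1]$ be real numbers; if $q=1$, assume $0<p<1$. For $c:E\to(0,\infty)$ let $\Delta_c$ be the graph Laplacian $$\Delta_c f(x)=\sum_{y\in V}\ \sum_{e\in E \text{ joining } x \text{ and } y} c_e\,(f(x)-f(y)),\qquad f:V\to\mathbb{R},$$ and let $\det\Delta_c$ denote the determinant of $\Delta_c$ as a linear map on $H_0=\{f:V\to\mathbb{R}:\sum_{x\in V} f(x)=0\}$. For $\kappa\in\{1,q\}^E$ put $h(\kappa)=|\{e\in E:\kappa_e=q\}|$, $s(\kappa)=|\{e\in E:\kappa_e=1\}|$ and $$\mathbb{P}^{G,p}(\kappa)=\frac1Z\,\frac{p^{h(\kappa)}(1-p)^{s(\kappa)}}{\sqrt{\det\Delta_\kappa}},\qquad Z=\sum_{\kappa'\in\{1,q\}^E}\frac{p^{h(\kappa')}(1-p)^{s(\kappa')}}{\sqrt{\det\Delta_{\kappa'}}}.$$ Order $\{1,q\}^E$ coordinatewise and let $\wedge$ and $\vee$ be the coordinatewise minimum and maximum. Then $\det\Delta_\kappa>0$ for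 all $\kappa\in\{1,q\}^E$, $\mathbb{P}^{G,p}$ is a probability measure on $\{1,q\}^E$, and it satisfies the FKG lattice condition $$\mathbb{P}^{G,p}(\kappa_1\wedge\kappa_2)\,\mathbb{P}^{G,p}(\kappa_1\vee\kappa_2)\ \ge\ \mathbb{P}^{G,p}(\kappa_1)\,\mathbb{P}^{G,p}(\kappa_2)\qquad\text{for all }\kappa_1,\kappa_2\in\{1,q\}^E$$ and the FKG inequality $$\mathbb{E}^{G,p}(XY)\ \ge\ \mathbb{E}^{G,p}(X)\,\mathbb{E}^{G,p}(Y)$$ for all increasing functions $X,Y:\{1,q\}^E\to\mathbb{R}$, where $\mathbb{E}^{G,p}$ is the expectation with respect to $\mathbb{P}^{G,p}$. -/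

import Mathlib

open scoped Graph

namespace RandomConductance

variable {α β : Type*}

open Classical in
/-- The nonnegative graph Laplacian with conductances `c`, acting on functions on the vertices of a
graph that may have multiple edges and loops:
`(Δ_c f)(x) = ∑_y ∑_{e joins x and y} c_e (f x - f y)`. Loops do not contribute. -/
noncomputable def laplacian (G : Graph α β) [Fintype V(G)] [Fintype E(G)] (c : E(G) → ℝ) :
    (V(G) → ℝ) →ₗ[ℝ] (V(G) → ℝ) where
  toFun f x := ∑ y : V(G), ∑ e : E(G), if G.IsLink e x y then c e * (f x - f y) else 0
  map_add' f g := by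
    ext x
    simp only [Pi.add_apply, ← Finset.sum_add_distrib]
    exact Finset.sum_congr rfl fun y _ => Finset.sum_congr rfl fun e _ => by split_ifs <;> ring
  map_smul' r f := by
    ext x
    simp only [Pi.smul_apply, smul_eq_mul, RingHom.id_apply, Finset.mul_sum]
    exact Finset.sum_congr rfl fun y _ => Finset.sum_congr rfl fun e _ => by split_ifs <;> ring

/-- The space `H₀` of real functions on the vertices with vanishing average. -/
def zeroSum (V : Type*) [Fintype V] : Submodule ℝ (V → ℝ) where
  carrier := {f | ∑ x, f x = 0}
  add_mem' {f g} hf hg := by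
    change ∑ x, f x = 0 at hf
    change ∑ x, g x = 0 at hg
    change ∑ x, (f x + g x) = 0
    rw [Finset.sum_add_distrib, hf, hg, add_zero]
  zero_mem' := by simp
  smul_mem' r f hf := by
    change ∑ x, f x = 0 at hf
    change ∑ x, r * f x = 0
    rw [← Finset.mul_sum, hf, mul_zero]

theorem laplacian_mem_zeroSum (G : Graph α β) [Fintype V(G)] [Fintype E(G)] (c : E(G) → ℝ)
    (f : V(G) → ℝ) : laplacian G c f ∈ zeroSum V(G) := by
  classical
  let F (x y : V(G)) : ℝ := ∑ e : E(G), if G.IsLink e x y then c e * (f x - f y) else 0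
  change ∑ x, ∑ y, F x y = 0
  have hF (x y : V(G)) : F y x = - F x y := by
    simp only [F, ← Finset.sum_neg_distrib]
    refine Finset.sum_congr rfl fun e _ => ?_
    simp only [G.isLink_comm (x := (y : α)) (y := (x : α))]
    split_ifs <;> ring
  have key : ∑ x, ∑ y, F x y = - ∑ x, ∑ y, F x y := by
    conv_lhs => rw [Finset.sum_comm]
    simp only [← Finset.sum_neg_distrib]
    exact Finset.sum_congr rfl fun x _ => Finset.sum_congr rfl fun y _ => hF x y
  linarith

/-- The determinant of the Laplacian, viewed as a linear map on `H₀`. -/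
noncomputable def detLaplacian (G : Graph α β) [Fintype V(G)] [Fintype E(G)] (c : E(G) → ℝ) : ℝ :=
  LinearMap.det ((laplacian G c).restrict
    fun f (_ : f ∈ zeroSum V(G)) => laplacian_mem_zeroSum G c f)

/-- The configuration space `{1, q}^E`; its order and its lattice operations `⊓`, `⊔` are the
pointwise ones of real numbers. -/
abbrev Config (E : Type*) (q : ℝ) : Type _ := E → ({1, q} : Set ℝ)

/-- The number of hard edges. -/
noncomputable def h {E : Type*} {q : ℝ} (κ : Config E q) : ℕ := Nat.card {e : E // (κ e : ℝ) = q}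

/-- The number of soft edges. -/
noncomputable def s {E : Type*} {q : ℝ} (κ : Config E q) : ℕ := Nat.card {e : E // (κ e : ℝ) = 1}

/-- The unnormalised weight `p^h(κ) (1-p)^s(κ) / √(det Δ_κ)`. -/
noncomputable def weight (G : Graph α β) [Fintype V(G)] [Fintype E(G)] (p : ℝ) {q : ℝ}
    (κ : Config E(G) q) : ℝ :=
  p ^ h κ * (1 - p) ^ s κ / √(detLaplacian G fun e => (κ e : ℝ))

open Classical in
/-- The normalisation constant `Z`. -/
noncomputable def partitionFunction (G : Graph α β) [Fintype V(G)] [Fintype E(G)] (p q : ℝ) : ℝ :=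
  ∑ κ : Config E(G) q, weight G p κ

/-- The random conductance measure `ℙ^{G,p}` on the finite set `{1, q}^E`, given by the
probability of each configuration. -/
noncomputable def prob (G : Graph α β) [Fintype V(G)] [Fintype E(G)] (p : ℝ) {q : ℝ}
    (κ : Config E(G) q) : ℝ :=
  weight G p κ / partitionFunction G p q

open Classical in
/-- The expectation `𝔼^{G,p}(X)`. -/
noncomputable def expect (G : Graph α β) [Fintype V(G)] [Fintype E(G)] (p : ℝ) {q : ℝ}
    (X : Config E(G) q → ℝ) : ℝ :=
  ∑ κ : Config E(G) q, prob G p κ * X κ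

end RandomConductance

/-! At each edge the minimum and maximum are the two given values in some order, so the factors `p ^
h κ * (1 - p) ^ s κ` cancel from the lattice condition. What remains is log-submodularity of `c ↦
det Δ_c`. On `H₀`, `Δ_c = ∑ c_e ⟨u_e, ·⟩ u_e` with incidence vectors `u_e`, and connectedness makes
it positive definite. Starting from `T = Δ_{c ⊓ d}`, the increments to `c` and to `d` are positive
semidefinite and together lead to `c ⊔ d`. Add the first increment one edge at a time: each step
multiplies the determinant of the current operator `M` by `1 + a ⟨u, M⁻¹ u⟩`, and this factor can
only shrink when the second increment is present, by Rayleigh monotonicity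
(`det_add_add_rankOneSum_mul_det_le`). Mathlib's `fkg` then turns the lattice condition into the FKG
inequality. -/

namespace RandomConductance

/-! ### Determinants of positive definite operators -/

section Determinants

variable {E : Type*} [AddCommGroup E] [Module ℝ E]

/-- `T` is symmetric and positive definite with respect to the bilinear form `B`. -/
structure IsPosDefOp (B : LinearMap.BilinForm ℝ E) (T : E →ₗ[ℝ] E) : Prop where
  symm : ∀ x y, B (T x) y = B x (T y)
  pos : ∀ x, x ≠ 0 → 0 < B (T x) x

/-- `T` is symmetric and positive semidefinite with respect to the bilinear form `B`. -/
structure IsPosSemidefOp (B : LinearMap.BilinForm ℝ E) (T : E →ₗ[ℝ] E) : Prop where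
  symm : ∀ x y, B (T x) y = B x (T y)
  nonneg : ∀ x, 0 ≤ B (T x) x

variable {B : LinearMap.BilinForm ℝ E} {S T : E →ₗ[ℝ] E}

theorem IsPosDefOp.nonneg (hT : IsPosDefOp B T) (x : E) : 0 ≤ B (T x) x := by
  rcases eq_or_ne x 0 with rfl | hx
  · simp
  · exact (hT.pos x hx).le

theorem IsPosDefOp.add_isPosSemidefOp (hT : IsPosDefOp B T) (hS : IsPosSemidefOp B S) :
    IsPosDefOp B (T + S) where
  symm x y := by simp [hT.symm, hS.symm]
  pos x hx := by
    simpa using add_pos_of_pos_of_nonneg (hT.pos x hx) (hS.nonneg x)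

theorem IsPosDefOp.injective (hT : IsPosDefOp B T) : Function.Injective T := by
  rw [injective_iff_map_eq_zero]
  intro x hx
  by_contra h
  simpa [hx] using hT.pos x h

/-- The determinant of the path from the identity to `T` never vanishes. -/
theorem IsPosDefOp.det_pos [FiniteDimensional ℝ E] (hB : ∀ x, x ≠ 0 → 0 < B x x)
    (hT : IsPosDefOp B T) : 0 < LinearMap.det T := by
  let b := Module.finBasis ℝ E
  let F : ℝ → ℝ := fun t => LinearMap.det (t • T + (1 - t) • LinearMap.id)
  have hF : Continuous F := by
    have : F = fun t => (t • LinearMap.toMatrix b b T + (1 - t) • (1 : Matrix _ _ ℝ)).det := by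
      ext t
      simp only [F]
      rw [← LinearMap.det_toMatrix b, map_add, map_smul, map_smul, LinearMap.toMatrix_id]
    rw [this]
    fun_prop
  -- A kernel vector `x ≠ 0` would make a convex combination of the positive numbers `B (T x) x` and
  -- `B x x` vanish.
  have hne (t : ℝ) (ht : t ∈ Set.Icc (0 : ℝ) 1) : F t ≠ 0 := by
    intro h0
    have hlt := LinearMap.bot_lt_ker_of_det_eq_zero h0
    obtain ⟨x, hx, hx0⟩ := (Submodule.ne_bot_iff _).1 hlt.ne'
    have h1 : B ((t • T + (1 - t) • (LinearMap.id : E →ₗ[ℝ] E)) x) x = 0 := by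
      rw [LinearMap.mem_ker.1 hx]; simp
    simp only [LinearMap.add_apply, LinearMap.smul_apply, LinearMap.id_apply, map_add, map_smul,
      smul_eq_mul] at h1
    have h2 := hT.pos x hx0
    have h3 := hB x hx0
    rcases ht.1.eq_or_lt with h | h
    · subst h; simp at h1; exact h3.ne' h1
    · nlinarith [mul_pos h h2, mul_nonneg (sub_nonneg.2 ht.2) h3.le]
  have h0 : F 0 = 1 := by simp [F]
  have h1 : F 1 = LinearMap.det T := by simp [F]
  by_contra hneg
  rw [not_lt, ← h1] at hneg
  obtain ⟨t, ht, h⟩ := intermediate_value_Icc' zero_le_one hF.continuousOn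
    (show (0 : ℝ) ∈ Set.Icc (F 1) (F 0) from ⟨hneg, by rw [h0]; exact zero_le_one⟩)
  exact hne t ht h

/-- Matrix determinant lemma: factoring out `T` leaves a transvection. Writing the vector as `T w`
avoids inverting `T`. -/
theorem det_add_smulRight [FiniteDimensional ℝ E] (T : E →ₗ[ℝ] E) (φ : E →ₗ[ℝ] ℝ) (w : E) :
    LinearMap.det (T + φ.smulRight (T w)) = LinearMap.det T * (1 + φ w) := by
  have : T + φ.smulRight (T w) = T ∘ₗ LinearMap.transvection φ w := by
    ext x
    simp [LinearMap.transvection.apply]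
  rw [this, LinearMap.det_comp, LinearMap.transvection.det]

/-- Inverses of positive definite operators are antitone. -/
theorem IsPosDefOp.apply_inv_add_le (hB : ∀ x y, B x y = B y x) (hT : IsPosDefOp B T)
    (hS : IsPosSemidefOp B S) {x y : E} (h : T x = (T + S) y) : B (T x) y ≤ B (T x) x := by
  -- Here `x = T⁻¹ v` and `y = (T + S)⁻¹ v` for a common `v`. Expanding `B (T (x - y)) (x - y) ≥ 0`
  -- gives `B (T x) x - B (T x) y ≥ B (S y) y ≥ 0`.
  have h1 := hT.nonneg (x - y)
  have h2 := hS.nonneg y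
  have h3 : B (T x) y = B (T y) y + B (S y) y := by rw [h]; simp
  have h4 : B (T y) x = B (T x) y := by rw [hT.symm, hB]
  simp only [map_sub, LinearMap.sub_apply] at h1
  linarith

/-- The operator `∑ i ∈ s, c i • ⟨u i, ·⟩ u i`. -/
noncomputable def rankOneSum {ι : Type*} (B : LinearMap.BilinForm ℝ E) (u : ι → E) (c : ι → ℝ)
    (s : Finset ι) : E →ₗ[ℝ] E :=
  ∑ i ∈ s, c i • (B (u i)).smulRight (u i)

theorem rankOneSum_quadratic {ι : Type*} (u : ι → E) (c : ι → ℝ) (s : Finset ι) (x : E) :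
    B (rankOneSum B u c s x) x = ∑ i ∈ s, c i * B (u i) x ^ 2 := by
  simp only [rankOneSum, LinearMap.sum_apply, map_sum, LinearMap.smul_apply, map_smul,
    LinearMap.smulRight_apply, smul_eq_mul]
  exact Finset.sum_congr rfl fun i _ => by ring

theorem rankOneSum_symm (hB : ∀ x y, B x y = B y x) {ι : Type*} (u : ι → E) (c : ι → ℝ)
    (s : Finset ι) (x y : E) : B (rankOneSum B u c s x) y = B x (rankOneSum B u c s y) := by
  simp only [rankOneSum, LinearMap.sum_apply, map_sum, LinearMap.smul_apply, map_smul,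
    LinearMap.smulRight_apply, smul_eq_mul]
  exact Finset.sum_congr rfl fun i _ => by rw [hB x]; ring

theorem isPosSemidefOp_rankOneSum (hB : ∀ x y, B x y = B y x) {ι : Type*} (u : ι → E) {c : ι → ℝ}
    (hc : ∀ i, 0 ≤ c i) (s : Finset ι) : IsPosSemidefOp B (rankOneSum B u c s) where
  symm := rankOneSum_symm hB u c s
  nonneg x := by
    rw [rankOneSum_quadratic]
    exact Finset.sum_nonneg fun i _ => mul_nonneg (hc i) (sq_nonneg _)

theorem rankOneSum_add {ι : Type*} (u : ι → E) (c d : ι → ℝ) (s : Finset ι) :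
    rankOneSum B u (c + d) s = rankOneSum B u c s + rankOneSum B u d s := by
  simp only [rankOneSum, Pi.add_apply, add_smul, Finset.sum_add_distrib]

/-- Log-submodularity of the determinant. -/
theorem det_add_add_rankOneSum_mul_det_le [FiniteDimensional ℝ E] (hB : ∀ x y, B x y = B y x)
    (hB' : ∀ x, x ≠ 0 → 0 < B x x) (hT : IsPosDefOp B T) (hS : IsPosSemidefOp B S)
    {ι : Type*} (u : ι → E) {c : ι → ℝ} (hc : ∀ i, 0 ≤ c i) (s : Finset ι) :
    LinearMap.det (T + rankOneSum B u c s + S) * LinearMap.det T ≤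
      LinearMap.det (T + rankOneSum B u c s) * LinearMap.det (T + S) := by
  classical
  induction s using Finset.induction_on with
  | empty => simp [rankOneSum, mul_comm]
  | insert a s ha ih =>
    set R := rankOneSum B u c s with hR
    have hRa : rankOneSum B u c (insert a s) = (c a • B (u a)).smulRight (u a) + R := by
      rw [hR, rankOneSum, Finset.sum_insert ha, rankOneSum]
      congr 1
      ext x
      simp [mul_smul]
    have hM : IsPosDefOp B (T + R) :=
      hT.add_isPosSemidefOp (isPosSemidefOp_rankOneSum hB u hc s)
    have hMS := hM.add_isPosSemidefOp hS
    -- The factors contributed by edge `a` without and with `S` are governed by `x = (T + R)⁻¹ u_a`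
    -- and `y = (T + R + S)⁻¹ u_a`.
    obtain ⟨x, hx⟩ := LinearMap.injective_iff_surjective.1 hM.injective (u a)
    obtain ⟨y, hy⟩ := LinearMap.injective_iff_surjective.1 hMS.injective (u a)
    have hxy : B (u a) y ≤ B (u a) x := by
      have := hM.apply_inv_add_le hB hS (hx.trans hy.symm)
      rwa [hx] at this
    have hy0 : 0 ≤ B (u a) y := by
      have := hMS.nonneg y
      rwa [hy] at this
    have e1 : LinearMap.det (T + rankOneSum B u c (insert a s) + S) =
        LinearMap.det (T + R + S) * (1 + c a * B (u a) y) := by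
      have := det_add_smulRight (T + R + S) (c a • B (u a)) y
      rw [hy] at this
      rw [LinearMap.smul_apply, smul_eq_mul] at this
      rw [hRa, ← this]
      congr 1
      abel
    have e2 : LinearMap.det (T + rankOneSum B u c (insert a s)) =
        LinearMap.det (T + R) * (1 + c a * B (u a) x) := by
      have := det_add_smulRight (T + R) (c a • B (u a)) x
      rw [hx] at this
      rw [LinearMap.smul_apply, smul_eq_mul] at this
      rw [hRa, ← this]
      congr 1
      abel
    have hle : 1 + c a * B (u a) y ≤ 1 + c a * B (u a) x := by
      gcongr
      exact hc a
    have h0 : 0 ≤ 1 + c a * B (u a) y := by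
      have := mul_nonneg (hc a) hy0
      linarith
    calc _ = LinearMap.det (T + R + S) * LinearMap.det T * (1 + c a * B (u a) y) := by
          rw [e1]; ring
      _ ≤ LinearMap.det (T + R) * LinearMap.det (T + S) * (1 + c a * B (u a) x) :=
          mul_le_mul ih hle h0 (mul_nonneg (hM.det_pos hB').le
            ((hT.add_isPosSemidefOp hS).det_pos hB').le)
      _ = _ := by rw [e2]; ring

end Determinants

/-! ### The Laplacian as a sum of rank-one operators -/

section Laplacian

/-- The standard scalar product on functions with vanishing average. -/
noncomputable def zeroSumForm (V : Type*) [Fintype V] : LinearMap.BilinForm ℝ (zeroSum V) :=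
  LinearMap.mk₂ ℝ (fun f g => (f : V → ℝ) ⬝ᵥ (g : V → ℝ))
    (fun f f' g => by simp [add_dotProduct]) (fun r f g => by simp [smul_dotProduct])
    (fun f g g' => by simp [dotProduct_add]) (fun r f g => by simp [dotProduct_smul])

theorem zeroSumForm_apply {V : Type*} [Fintype V] (f g : zeroSum V) :
    zeroSumForm V f g = (f : V → ℝ) ⬝ᵥ (g : V → ℝ) := rfl

theorem zeroSumForm_comm {V : Type*} [Fintype V] (f g : zeroSum V) :
    zeroSumForm V f g = zeroSumForm V g f := dotProduct_comm _ _

theorem zeroSumForm_pos {V : Type*} [Fintype V] (f : zeroSum V) (hf : f ≠ 0) :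
    0 < zeroSumForm V f f := by
  rw [zeroSumForm_apply]
  refine lt_of_le_of_ne (Finset.sum_nonneg fun i _ => mul_self_nonneg _) fun h => hf ?_
  exact Subtype.ext (dotProduct_self_eq_zero.1 h.symm)

variable (G : Graph α β)

theorem exists_isLink_vertexSet (e : E(G)) : ∃ a b : V(G), G.IsLink e a b := by
  obtain ⟨x, y, h⟩ := G.exists_isLink_of_mem_edgeSet e.2
  exact ⟨⟨x, h.left_mem⟩, ⟨y, h.right_mem⟩, h⟩

variable [Fintype V(G)]

open Classical in
/-- The signed incidence vector of an edge, for an arbitrary orientation. -/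
noncomputable def incidenceVec (e : E(G)) : zeroSum V(G) :=
  ⟨Pi.single (exists_isLink_vertexSet G e).choose 1 -
      Pi.single (exists_isLink_vertexSet G e).choose_spec.choose 1, by
    change ∑ x, _ = 0
    simp [Finset.sum_sub_distrib]⟩

open Classical in
theorem exists_incidenceVec_eq (e : E(G)) : ∃ a b : V(G), G.IsLink e a b ∧
    (incidenceVec G e : V(G) → ℝ) = Pi.single a 1 - Pi.single b 1 :=
  ⟨_, _, (exists_isLink_vertexSet G e).choose_spec.choose_spec, rfl⟩

-- The product of the two incidence terms is insensitive to the chosen orientation, and a loop has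
-- incidence vector zero.
open Classical in
theorem sum_ite_isLink (e : E(G)) (c : ℝ) (f : zeroSum V(G)) (x : V(G)) :
    (∑ y : V(G), if G.IsLink e x y then c * ((f : V(G) → ℝ) x - (f : V(G) → ℝ) y) else 0) =
      c * (zeroSumForm V(G) (incidenceVec G e) f * (incidenceVec G e : V(G) → ℝ) x) := by
  obtain ⟨a, b, hab, h⟩ := exists_incidenceVec_eq G e
  rw [zeroSumForm_apply, h]
  have hl (y : V(G)) : G.IsLink e x y ↔ (a = x ∧ b = y) ∨ (a = y ∧ b = x) := by
    rw [hab.isLink_iff]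
    simp only [Subtype.ext_iff]
  simp only [hl, sub_dotProduct, single_dotProduct, one_mul, Pi.sub_apply, Pi.single_apply]
  by_cases hax : a = x <;> by_cases hbx : b = x
  · subst hax; subst hbx; simp
  · subst hax
    simp [hbx, Ne.symm hbx]
  · subst hbx
    simp [hax, Ne.symm hax]
  · simp [hax, hbx, Ne.symm hax, Ne.symm hbx]

variable {G} in
theorem eq_of_isLink_of_zeroSumForm_incidenceVec_eq_zero {f : zeroSum V(G)}
    (h : ∀ e, zeroSumForm V(G) (incidenceVec G e) f = 0) {x y : V(G)} (hxy : G.Adj x y) :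
    (f : V(G) → ℝ) x = (f : V(G) → ℝ) y := by
  classical
  obtain ⟨e, he⟩ := hxy
  obtain ⟨a, b, hab, hv⟩ := exists_incidenceVec_eq G ⟨e, he.edge_mem⟩
  have h1 := h ⟨e, he.edge_mem⟩
  rw [zeroSumForm_apply, hv, sub_dotProduct, single_dotProduct, single_dotProduct] at h1
  have h2 : (f : V(G) → ℝ) a = (f : V(G) → ℝ) b := by linarith
  rcases hab.eq_and_eq_or_eq_and_eq he with ⟨h3, h4⟩ | ⟨h3, h4⟩
  · rwa [Subtype.ext h3, Subtype.ext h4] at h2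
  · rw [Subtype.ext h3, Subtype.ext h4] at h2
    exact h2.symm

variable [Fintype E(G)]

theorem laplacian_restrict_eq (c : E(G) → ℝ) :
    ((laplacian G c).restrict fun f (_ : f ∈ zeroSum V(G)) => laplacian_mem_zeroSum G c f) =
      rankOneSum (zeroSumForm V(G)) (incidenceVec G) c Finset.univ := by
  classical
  refine LinearMap.ext fun f => Subtype.ext (funext fun x => ?_)
  change (∑ y : V(G), ∑ e : E(G), if G.IsLink e x y then c e * ((f : V(G) → ℝ) x -
    (f : V(G) → ℝ) y) else 0) = _
  rw [Finset.sum_comm]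
  simp only [rankOneSum, LinearMap.sum_apply, LinearMap.smul_apply, LinearMap.smulRight_apply,
    Submodule.coe_sum, Submodule.coe_smul, Finset.sum_apply, Pi.smul_apply, smul_eq_mul]
  refine Finset.sum_congr rfl fun e _ => ?_
  rw [← sum_ite_isLink]

theorem detLaplacian_eq (c : E(G) → ℝ) : detLaplacian G c =
    LinearMap.det (rankOneSum (zeroSumForm V(G)) (incidenceVec G) c Finset.univ) := by
  rw [detLaplacian, laplacian_restrict_eq]

variable {G}

/-- If the quadratic form vanishes at `f`, then `f` agrees across every edge, hence is constant by
connectedness, and zero because its sum is zero. -/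
theorem isPosDefOp_rankOneSum_incidenceVec (hG : G.toSimpleGraph.Connected) {c : E(G) → ℝ}
    (hc : ∀ e, 0 < c e) : IsPosDefOp (zeroSumForm V(G))
      (rankOneSum (zeroSumForm V(G)) (incidenceVec G) c Finset.univ) where
  symm := rankOneSum_symm zeroSumForm_comm _ _ _
  pos f hf := by
    rw [rankOneSum_quadratic]
    have hnn : ∀ e ∈ Finset.univ, 0 ≤ c e * zeroSumForm V(G) (incidenceVec G e) f ^ 2 :=
      fun e _ => mul_nonneg (hc e).le (sq_nonneg _)
    refine lt_of_le_of_ne (Finset.sum_nonneg hnn) fun h => hf ?_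
    have h0 (e : E(G)) : zeroSumForm V(G) (incidenceVec G e) f = 0 := by
      have := (Finset.sum_eq_zero_iff_of_nonneg hnn).1 h.symm e (Finset.mem_univ e)
      simpa [(hc e).ne'] using this
    have hconst (x y : V(G)) : (f : V(G) → ℝ) x = (f : V(G) → ℝ) y := by
      obtain ⟨w⟩ := hG.preconnected x y
      induction w with
      | nil => rfl
      | cons hadj _ ih =>
        exact (eq_of_isLink_of_zeroSumForm_incidenceVec_eq_zero h0 hadj.2).trans ih
    refine Subtype.ext (funext fun x => ?_)
    have hsum : ∑ y, (f : V(G) → ℝ) y = 0 := f.2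
    rw [Finset.sum_congr rfl fun y _ => hconst y x, Finset.sum_const, nsmul_eq_mul] at hsum
    exact (mul_eq_zero.1 hsum).resolve_left
      (Nat.cast_ne_zero.2 (Finset.card_ne_zero_of_mem (Finset.mem_univ x)))

theorem detLaplacian_pos (hG : G.toSimpleGraph.Connected) {c : E(G) → ℝ} (hc : ∀ e, 0 < c e) :
    0 < detLaplacian G c := by
  rw [detLaplacian_eq]
  exact (isPosDefOp_rankOneSum_incidenceVec hG hc).det_pos zeroSumForm_pos

theorem detLaplacian_inf_mul_sup_le (hG : G.toSimpleGraph.Connected) {c d : E(G) → ℝ}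
    (hc : ∀ e, 0 < c e) (hd : ∀ e, 0 < d e) :
    detLaplacian G (c ⊓ d) * detLaplacian G (c ⊔ d) ≤ detLaplacian G c * detLaplacian G d := by
  have hm : ∀ e, 0 < (c ⊓ d) e := fun e => lt_min (hc e) (hd e)
  have key := det_add_add_rankOneSum_mul_det_le zeroSumForm_comm zeroSumForm_pos
    (isPosDefOp_rankOneSum_incidenceVec hG hm)
    (isPosSemidefOp_rankOneSum zeroSumForm_comm (incidenceVec G) (c := d - c ⊓ d)
      (fun e => sub_nonneg.2 (min_le_right _ _)) Finset.univ)
    (incidenceVec G) (c := c - c ⊓ d) (fun e => sub_nonneg.2 (min_le_left _ _)) Finset.univ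
  simp only [← rankOneSum_add, ← detLaplacian_eq] at key
  have h1 : c ⊓ d + (c - c ⊓ d) + (d - c ⊓ d) = c ⊔ d := by
    rw [add_sub_cancel, ← add_sub_assoc, sub_eq_iff_eq_add, add_comm (c ⊔ d), inf_add_sup]
  rwa [h1, add_sub_cancel, add_sub_cancel, mul_comm] at key

end Laplacian

/-! ### The random conductance measure and FKG -/

section Measure

theorem config_inf_apply {E : Type*} {q : ℝ} (κ₁ κ₂ : Config E q) (e : E) :
    ((κ₁ ⊓ κ₂) e : ℝ) = (κ₁ e : ℝ) ⊓ κ₂ e := by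
  rw [Pi.inf_apply]
  exact (Subtype.mono_coe _).map_min

theorem config_sup_apply {E : Type*} {q : ℝ} (κ₁ κ₂ : Config E q) (e : E) :
    ((κ₁ ⊔ κ₂) e : ℝ) = (κ₁ e : ℝ) ⊔ κ₂ e := by
  rw [Pi.sup_apply]
  exact (Subtype.mono_coe _).map_max

theorem card_inf_add_card_sup {E : Type*} [Finite E] {q : ℝ} (r : ℝ) (κ₁ κ₂ : Config E q) :
    Nat.card {e // ((κ₁ ⊓ κ₂) e : ℝ) = r} + Nat.card {e // ((κ₁ ⊔ κ₂) e : ℝ) = r} =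
      Nat.card {e // (κ₁ e : ℝ) = r} + Nat.card {e // (κ₂ e : ℝ) = r} := by
  classical
  have := Fintype.ofFinite E
  simp only [Nat.card_eq_fintype_card, Fintype.card_subtype, Finset.card_filter,
    ← Finset.sum_add_distrib]
  refine Finset.sum_congr rfl fun e _ => ?_
  rw [config_inf_apply, config_sup_apply]
  rcases le_total (κ₁ e : ℝ) (κ₂ e) with h | h
  · rw [inf_eq_left.2 h, sup_eq_right.2 h]
  · rw [inf_eq_right.2 h, sup_eq_left.2 h, add_comm]

variable {G : Graph α β} [Fintype V(G)] [Fintype E(G)] {p q : ℝ}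

theorem config_pos {E : Type*} (hq : 1 ≤ q) (κ : Config E q) (e : E) : 0 < (κ e : ℝ) := by
  rcases (κ e).2 with h | h
  · rw [h]; exact one_pos
  · rw [Set.mem_singleton_iff.1 h]; linarith

theorem weight_nonneg (hp0 : 0 ≤ p) (hp1 : p ≤ 1) (κ : Config E(G) q) : 0 ≤ weight G p κ :=
  div_nonneg (mul_nonneg (pow_nonneg hp0 _) (pow_nonneg (sub_nonneg.2 hp1) _)) (Real.sqrt_nonneg _)

theorem weight_mul_weight_le (hG : G.toSimpleGraph.Connected) (hp0 : 0 ≤ p) (hp1 : p ≤ 1)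
    (hq : 1 ≤ q) (κ₁ κ₂ : Config E(G) q) :
    weight G p κ₁ * weight G p κ₂ ≤ weight G p (κ₁ ⊓ κ₂) * weight G p (κ₁ ⊔ κ₂) := by
  have hd (κ : Config E(G) q) : 0 < detLaplacian G fun e => (κ e : ℝ) :=
    detLaplacian_pos hG (config_pos hq κ)
  have hdet := detLaplacian_inf_mul_sup_le hG (config_pos hq κ₁) (config_pos hq κ₂)
  have hi : ((fun e => (κ₁ e : ℝ)) ⊓ fun e => (κ₂ e : ℝ)) = fun e => ((κ₁ ⊓ κ₂) e : ℝ) :=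
    funext fun e => (config_inf_apply κ₁ κ₂ e).symm
  have hs : ((fun e => (κ₁ e : ℝ)) ⊔ fun e => (κ₂ e : ℝ)) = fun e => ((κ₁ ⊔ κ₂) e : ℝ) :=
    funext fun e => (config_sup_apply κ₁ κ₂ e).symm
  rw [hi, hs] at hdet
  have hnum : p ^ h κ₁ * (1 - p) ^ s κ₁ * (p ^ h κ₂ * (1 - p) ^ s κ₂) =
      p ^ h (κ₁ ⊓ κ₂) * (1 - p) ^ s (κ₁ ⊓ κ₂) * (p ^ h (κ₁ ⊔ κ₂) * (1 - p) ^ s (κ₁ ⊔ κ₂)) := by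
    rw [mul_mul_mul_comm, ← pow_add, ← pow_add, mul_mul_mul_comm, ← pow_add, ← pow_add,
      h, h, h, h, s, s, s, s, card_inf_add_card_sup, card_inf_add_card_sup]
  have hp1' := sub_nonneg.2 hp1
  simp only [weight]
  rw [div_mul_div_comm, div_mul_div_comm, ← hnum, ← Real.sqrt_mul (hd _).le,
    ← Real.sqrt_mul (hd _).le]
  refine div_le_div_of_nonneg_left (by positivity)
    (Real.sqrt_pos.2 (mul_pos (hd _) (hd _))) (Real.sqrt_le_sqrt hdet)

theorem exists_weight_pos (hG : G.toSimpleGraph.Connected) (hp0 : 0 ≤ p) (hp1 : p ≤ 1)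
    (hq : 1 ≤ q) (hpq : q = 1 → 0 < p ∧ p < 1) : ∃ κ : Config E(G) q, 0 < weight G p κ := by
  suffices ∃ κ : Config E(G) q, 0 < p ^ h κ * (1 - p) ^ s κ by
    obtain ⟨κ, hκ⟩ := this
    exact ⟨κ, div_pos hκ (Real.sqrt_pos.2 (detLaplacian_pos hG (config_pos hq κ)))⟩
  rcases hp0.eq_or_lt with rfl | hp0
  -- At `p = 0` necessarily `q ≠ 1`, so the all-soft configuration has no hard edge and `0 ^ 0 = 1`;
  -- symmetrically, `p = 1` uses the all-hard one.
  · refine ⟨fun _ => ⟨1, by simp⟩, ?_⟩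
    have hq1 : 1 ≠ q := fun h => (hpq h.symm).1.false
    simp [h, hq1]
  · rcases hp1.eq_or_lt with rfl | hp1
    · refine ⟨fun _ => ⟨q, by simp⟩, ?_⟩
      have hq1 : q ≠ 1 := fun h => (hpq h).2.false
      simp [s, hq1]
    · have := sub_pos.2 hp1
      exact ⟨fun _ => ⟨1, by simp⟩, by positivity⟩

theorem partitionFunction_pos (hG : G.toSimpleGraph.Connected) (hp0 : 0 ≤ p) (hp1 : p ≤ 1)
    (hq : 1 ≤ q) (hpq : q = 1 → 0 < p ∧ p < 1) : 0 < partitionFunction G p q := by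
  obtain ⟨κ, hκ⟩ := exists_weight_pos hG hp0 hp1 hq hpq
  classical
  exact Finset.sum_pos' (fun κ _ => weight_nonneg hp0 hp1 κ) ⟨κ, Finset.mem_univ κ, hκ⟩

/-- The FKG inequality for a probability vector, without sign conditions on the functions. -/
theorem sum_mul_sum_le_of_lattice_condition {L : Type*} [DistribLattice L] [Fintype L] {μ : L → ℝ}
    (hμ0 : 0 ≤ μ) (hμ1 : ∑ a, μ a = 1) (hμ : ∀ a b, μ a * μ b ≤ μ (a ⊓ b) * μ (a ⊔ b))
    {X Y : L → ℝ} (hX : Monotone X) (hY : Monotone Y) :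
    (∑ a, μ a * X a) * ∑ a, μ a * Y a ≤ ∑ a, μ a * (X a * Y a) := by
  classical
  -- `fkg` needs nonnegative functions. Subtracting lower bounds is harmless, since covariance under
  -- a measure of mass one is unchanged by constants.
  obtain ⟨m, hm⟩ := (Set.finite_range X).bddBelow
  obtain ⟨n, hn⟩ := (Set.finite_range Y).bddBelow
  have key := fkg (fun a => X a - m) (fun a => Y a - n) μ hμ0
    (fun a => sub_nonneg.2 (hm ⟨a, rfl⟩)) (fun a => sub_nonneg.2 (hn ⟨a, rfl⟩))
    (fun a b hab => sub_le_sub_right (hX hab) m) (fun a b hab => sub_le_sub_right (hY hab) n) hμ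
  have e (a : L) : μ a * ((X a - m) * (Y a - n)) =
      μ a * (X a * Y a) - μ a * X a * n - μ a * Y a * m + μ a * (m * n) := by ring
  simp only [e, Finset.sum_add_distrib, Finset.sum_sub_distrib, ← Finset.sum_mul, hμ1] at key
  simp only [mul_sub, Finset.sum_sub_distrib, ← Finset.sum_mul, hμ1] at key
  linarith

end Measure

end RandomConductance

theorem mainTheorem11 {α β : Type*} (G : Graph α β) [Fintype V(G)] [Fintype E(G)]
    (hG : G.toSimpleGraph.Connected)
    (p q : ℝ) (hp0 : 0 ≤ p) (hp1 : p ≤ 1) (hq : 1 ≤ q)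
    (hpq : q = 1 → 0 < p ∧ p < 1) :
    -- the measure is well defined and is a probability measure on `{1, q}^E`
    (∀ κ : RandomConductance.Config E(G) q,
      0 < RandomConductance.detLaplacian G (fun e => (κ e : ℝ))) ∧
    (∀ κ : RandomConductance.Config E(G) q, 0 ≤ RandomConductance.prob G p κ) ∧
    RandomConductance.expect G p (fun _ : RandomConductance.Config E(G) q => 1) = 1 ∧
    -- the FKG lattice condition
    (∀ κ₁ κ₂ : RandomConductance.Config E(G) q,
      RandomConductance.prob G p (κ₁ ⊓ κ₂) * RandomConductance.prob G p (κ₁ ⊔ κ₂) ≥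
        RandomConductance.prob G p κ₁ * RandomConductance.prob G p κ₂) ∧
    -- the FKG inequality
    (∀ X Y : RandomConductance.Config E(G) q → ℝ, Monotone X → Monotone Y →
      RandomConductance.expect G p (fun κ => X κ * Y κ) ≥
        RandomConductance.expect G p X * RandomConductance.expect G p Y) := by
  classical
  have hZ := RandomConductance.partitionFunction_pos hG hp0 hp1 hq hpq
  have hprob (κ : RandomConductance.Config E(G) q) : 0 ≤ RandomConductance.prob G p κ :=
    div_nonneg (RandomConductance.weight_nonneg hp0 hp1 κ) hZ.le
  have hlat (κ₁ κ₂ : RandomConductance.Config E(G) q) :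
      RandomConductance.prob G p κ₁ * RandomConductance.prob G p κ₂ ≤
        RandomConductance.prob G p (κ₁ ⊓ κ₂) * RandomConductance.prob G p (κ₁ ⊔ κ₂) := by
    simp only [RandomConductance.prob, div_mul_div_comm]
    exact div_le_div_of_nonneg_right (RandomConductance.weight_mul_weight_le hG hp0 hp1 hq κ₁ κ₂)
      (mul_pos hZ hZ).le
  have hone : RandomConductance.expect G p (fun _ : RandomConductance.Config E(G) q => 1) = 1 := by
    simp only [RandomConductance.expect, RandomConductance.prob, mul_one]
    rw [← Finset.sum_div]
    exact div_self hZ.ne'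
  refine ⟨fun κ => RandomConductance.detLaplacian_pos hG (RandomConductance.config_pos hq κ),
    hprob, hone, hlat, fun X Y hX hY => ?_⟩
  simp only [RandomConductance.expect, mul_one] at hone
  exact RandomConductance.sum_mul_sum_le_of_lattice_condition hprob hone hlat hX hY
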